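/- Let $n\ge 0$ be an integer, $G=\mathrm{GL}(n,\mathbb C)$, $\mathcal G=\mathrm{gl}(n,\mathbb C)$, and $\langle X,Y\rangle=\operatorname{tr}(XY)$ for $X,Y\in\mathcal G$. For $X\in\mathcal G$ let $X_>$ and $X_<$ be its strictly upper and strictly lower triangular parts, and put $r(X)=\tfrac12(X_>-X_<)$ and $r_\pm=r\pm\tfrac12\,\mathrm{id}$. Let $\mathrm{Hol}(\mathfrak M)$ be the commutative algebra of holomorphic functions on the complex manifold $\mathfrak M=G\times\mathcal G=\{(g,L)\}$. For $F\in\mathrm{Hol}(\mathfrak M)$ define the $\mathcal G$-valued derivatives $\nabla_1F,\nabla_1'F,d_2F$ by requiring, for all $X\in\mathcal G$, $$\langle\nabla_1F(g,L),X\rangle=\tfrac{d}{dz}\Big|_{z=0}F(e^{zX}g,L),\quad \langle\nabla_1'F(g,L),X\rangle=\tfrac{d}{dz}\Big|_{z=0}F(ge^{zX},L),\quad \langle d_2F(g,L),X\rangle=\tfrac{d}{dz}\Big|_{z=0}F(g,L+zX),$$ where $z$ is a complex variable, and put $\nabla_2F(g,L)=L\,d_2F(g,L)$ and $\nabla_2'F(g,L)=(d_2F(g,L))\,L$.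 Theorem. Each of the following two formulae (with all derivatives evaluated at $(g,L)$) defines a Poisson bracket on $\mathrm{Hol}(\mathfrak M)$: $$\{F,H\}_1(g,L)=\langle\nabla_1F,d_2H\rangle-\langle\nabla_1H,d_2F\rangle+\langle L,[d_2F,d_2H]\rangle,$$ $$\begin{aligned}\{F,H\}_2(g,L)={}&\langle r\nabla_1F,\nabla_1H\rangle-\langle r\nabla_1'F,\nabla_1'H\rangle+\langle\nabla_2F-\nabla_2'F,\;r_+\nabla_2'H-r_-\nabla_2H\rangle\\&+\langle\nabla_1F,\;r_+\nabla_2'H-r_-\nabla_2H\rangle-\langle\nabla_1H,\;r_+\nabla_2'F-r_-\nabla_2F\rangle.\end{aligned}$$ That is, for $i=1,2$ and $F,H\in\mathrm{Hol}(\mathfrak M)$ the function $\{F,H\}_i$ is again holomorphic on $\mathfrak M$, and the operation $\{\cdot,\cdot\}_i$ on $\mathrm{Hol}(\mathfrak M)$ is $\mathbb C$-bilinear, antisymmetric, a derivation in each argument, and satisfies the Jacobi identity. -/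

import Mathlib

namespace GLPoisson

/-- The Lie algebra `gl(n, ℂ)`, as the matrix algebra. -/
abbrev Mat (n : ℕ) : Type := Matrix (Fin n) (Fin n) ℂ

/-- The complex manifold `M = GL(n, ℂ) × gl(n, ℂ)`. -/
abbrev Phase (n : ℕ) : Type := Matrix.GeneralLinearGroup (Fin n) ℂ × Mat n

/-- The trace form `⟨X, Y⟩ = tr (X Y)`. -/
def trForm {n : ℕ} (X Y : Mat n) : ℂ := (X * Y).trace

/-- The strictly upper triangular part of a matrix. -/
def upper {n : ℕ} (X : Mat n) : Mat n := Matrix.of fun i j => if i < j then X i j else 0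

/-- The strictly lower triangular part of a matrix. -/
def lower {n : ℕ} (X : Mat n) : Mat n := Matrix.of fun i j => if j < i then X i j else 0

/-- The standard `r`-matrix `r X = ½ (X_> - X_<)`. -/
noncomputable def r {n : ℕ} (X : Mat n) : Mat n := (1 / 2 : ℂ) • (upper X - lower X)

/-- `r₊ = r + ½ id`. -/
noncomputable def rPlus {n : ℕ} (X : Mat n) : Mat n := r X + (1 / 2 : ℂ) • X

/-- `r₋ = r - ½ id`. -/
noncomputable def rMinus {n : ℕ} (X : Mat n) : Mat n := r X - (1 / 2 : ℂ) • X

/-- Holomorphic functions on `M`, which is viewed as the open subset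
`{(A, L) | A invertible}` of the complex vector space `gl(n, ℂ) × gl(n, ℂ)`. -/
def IsHolomorphic {n : ℕ} (F : Phase n → ℂ) : Prop :=
  ∃ f : Mat n × Mat n → ℂ, DifferentiableOn ℂ f {p | IsUnit p.1} ∧
    ∀ (g : Matrix.GeneralLinearGroup (Fin n) ℂ) (L : Mat n), F (g, L) = f (g.val, L)

section Algebra

attribute [local instance] Matrix.linftyOpNormedRing Matrix.linftyOpNormedAlgebra

/-- The commutative algebra `Hol(M)` of holomorphic functions, with pointwise operations. -/
def Hol (n : ℕ) : Subalgebra ℂ (Phase n → ℂ) where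
  carrier := {F | IsHolomorphic F}
  mul_mem' := by
    rintro F H ⟨f, hf, hF⟩ ⟨h, hh, hH⟩
    exact ⟨fun p => f p * h p, fun p hp => (hf p hp).mul (hh p hp), fun g L => by simp [hF, hH]⟩
  add_mem' := by
    rintro F H ⟨f, hf, hF⟩ ⟨h, hh, hH⟩
    exact ⟨fun p => f p + h p, fun p hp => (hf p hp).add (hh p hp), fun g L => by simp [hF, hH]⟩
  algebraMap_mem' := fun c =>
    ⟨fun _ => c, fun _ _ => differentiableWithinAt_const c, fun _ _ => rfl⟩

end Algebra

/-- The matrix exponential as an element of `GL(n, ℂ)`. -/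
noncomputable def expGL {n : ℕ} (X : Mat n) : Matrix.GeneralLinearGroup (Fin n) ℂ :=
  (Matrix.isUnit_exp X).unit

/-- The matrix representing the linear form `φ` through the trace form,
`⟨traceDual φ, X⟩ = φ X`. -/
def traceDual {n : ℕ} (φ : Mat n → ℂ) : Mat n :=
  Matrix.of fun i j => φ (Matrix.single j i 1)

/-- `∇₁ F`, defined by `⟨∇₁ F (g, L), X⟩ = d/dz F (e^{zX} g, L)` at `z = 0`. -/
noncomputable def nabla1 {n : ℕ} (F : Phase n → ℂ) (x : Phase n) : Mat n :=
  traceDual fun X => deriv (fun z : ℂ => F (expGL (z • X) * x.1, x.2)) 0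

/-- `∇₁' F`, defined by `⟨∇₁' F (g, L), X⟩ = d/dz F (g e^{zX}, L)` at `z = 0`. -/
noncomputable def nabla1' {n : ℕ} (F : Phase n → ℂ) (x : Phase n) : Mat n :=
  traceDual fun X => deriv (fun z : ℂ => F (x.1 * expGL (z • X), x.2)) 0

/-- `d₂ F`, defined by `⟨d₂ F (g, L), X⟩ = d/dz F (g, L + z X)` at `z = 0`. -/
noncomputable def d2 {n : ℕ} (F : Phase n → ℂ) (x : Phase n) : Mat n :=
  traceDual fun X => deriv (fun z : ℂ => F (x.1, x.2 + z • X)) 0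

/-- `∇₂ F (g, L) = L (d₂ F (g, L))`. -/
noncomputable def nabla2 {n : ℕ} (F : Phase n → ℂ) (x : Phase n) : Mat n := x.2 * d2 F x

/-- `∇₂' F (g, L) = (d₂ F (g, L)) L`. -/
noncomputable def nabla2' {n : ℕ} (F : Phase n → ℂ) (x : Phase n) : Mat n := d2 F x * x.2

/-- The first bracket, evaluated at `x = (g, L)`. -/
noncomputable def bracket1 {n : ℕ} (F H : Phase n → ℂ) (x : Phase n) : ℂ :=
  trForm (nabla1 F x) (d2 H x) - trForm (nabla1 H x) (d2 F x) + trForm x.2 ⁅d2 F x, d2 H x⁆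

/-- The second bracket, evaluated at `x = (g, L)`. -/
noncomputable def bracket2 {n : ℕ} (F H : Phase n → ℂ) (x : Phase n) : ℂ :=
  trForm (r (nabla1 F x)) (nabla1 H x) - trForm (r (nabla1' F x)) (nabla1' H x)
    + trForm (nabla2 F x - nabla2' F x) (rPlus (nabla2' H x) - rMinus (nabla2 H x))
    + trForm (nabla1 F x) (rPlus (nabla2' H x) - rMinus (nabla2 H x))
    - trForm (nabla1 H x) (rPlus (nabla2' F x) - rMinus (nabla2 F x))

/-- A Poisson bracket on a commutative `ℂ`-algebra: a bilinear antisymmetric operation that is a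
derivation in each argument and satisfies the Jacobi identity. -/
structure IsPoissonBracket {A : Type*} [CommRing A] [Algebra ℂ A] (b : A → A → A) : Prop where
  add_left : ∀ F F' H, b (F + F') H = b F H + b F' H
  smul_left : ∀ (c : ℂ) F H, b (c • F) H = c • b F H
  add_right : ∀ F H H', b F (H + H') = b F H + b F H'
  smul_right : ∀ (c : ℂ) F H, b F (c • H) = c • b F H
  antisymm : ∀ F H, b F H = -b H F
  leibniz_left : ∀ F F' H, b (F * F') H = F * b F' H + b F H * F'
  leibniz_right : ∀ F H H', b F (H * H') = b F H * H' + H * b F H'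
  jacobi : ∀ F H K, b (b F H) K + b (b H K) F + b (b K F) H = 0

/-! The derivatives satisfy their defining relations for every `X` in the Lie algebra. -/

section DefiningRelations

open Matrix

attribute [local instance] Matrix.linftyOpNormedRing Matrix.linftyOpNormedAlgebra

theorem trForm_traceDual {n : ℕ} (φ : Mat n →ₗ[ℂ] ℂ) (X : Mat n) :
    trForm (traceDual φ) X = φ X := by
  conv_rhs => rw [Matrix.matrix_eq_sum_single X]
  simp only [trForm, Matrix.trace, Matrix.diag, Matrix.mul_apply, traceDual, Matrix.of_apply,
    map_sum]
  rw [Finset.sum_comm]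
  refine Finset.sum_congr rfl fun i _ => Finset.sum_congr rfl fun j _ => ?_
  have : Matrix.single i j (X i j) = X i j • Matrix.single i j (1 : ℂ) := by
    simp [Matrix.smul_single]
  rw [this, map_smul, smul_eq_mul, mul_comm]

theorem hasDerivAt_curve {n : ℕ} {F : Phase n → ℂ} (hF : IsHolomorphic F) (x : Phase n) :
    ∃ D : Mat n × Mat n →L[ℂ] ℂ, ∀ (c : ℂ → Phase n) (v w : Mat n), c 0 = x →
      HasDerivAt (fun z => (c z).1.val) v 0 → HasDerivAt (fun z => (c z).2) w 0 →
      HasDerivAt (fun z => F (c z)) (D (v, w)) 0 := by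
  obtain ⟨f, hf, hFf⟩ := hF
  have hopen : IsOpen {p : Mat n × Mat n | IsUnit p.1} :=
    Units.isOpen.preimage continuous_fst
  have hd : DifferentiableAt ℂ f (x.1.val, x.2) :=
    (hf (x.1.val, x.2) x.1.isUnit).differentiableAt (hopen.mem_nhds x.1.isUnit)
  refine ⟨fderiv ℂ f (x.1.val, x.2), fun c v w hc hv hw => ?_⟩
  have h1 : HasDerivAt (fun z => ((c z).1.val, (c z).2)) (v, w) 0 := hv.prodMk hw
  have h2 : HasFDerivAt f (fderiv ℂ f (x.1.val, x.2)) ((c 0).1.val, (c 0).2) := by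
    rw [hc]; exact hd.hasFDerivAt
  have h3 := h2.comp_hasDerivAt (0 : ℂ) h1
  have h4 : (fun z => F (c z)) = f ∘ fun z => ((c z).1.val, (c z).2) :=
    funext fun z => hFf (c z).1 (c z).2
  rw [h4]
  exact h3

theorem hasDerivAt_expGL {n : ℕ} (X : Mat n) :
    HasDerivAt (fun z : ℂ => (expGL (z • X)).val) X 0 := by
  have h := hasDerivAt_exp_smul_const (𝕂 := ℂ) X (0 : ℂ)
  rw [zero_smul, NormedSpace.exp_zero, one_mul] at h
  exact h

theorem expGL_zero {n : ℕ} : expGL (0 : Mat n) = 1 := by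
  ext1; simp [expGL]

theorem nabla1_spec {n : ℕ} {F : Phase n → ℂ} (hF : F ∈ Hol n) (x : Phase n) (X : Mat n) :
    HasDerivAt (fun z : ℂ => F (expGL (z • X) * x.1, x.2)) (trForm (nabla1 F x) X) 0 := by
  obtain ⟨D, hD⟩ := hasDerivAt_curve hF x
  have key : ∀ Y : Mat n, HasDerivAt (fun z : ℂ => F (expGL (z • Y) * x.1, x.2))
      (D (Y * x.1.val, 0)) 0 := fun Y =>
    hD (fun z => (expGL (z • Y) * x.1, x.2)) _ _ (by simp [expGL_zero])
      ((hasDerivAt_expGL Y).mul_const x.1.val) (hasDerivAt_const _ _)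
  have h := trForm_traceDual (D.toLinearMap ∘ₗ LinearMap.inl ℂ (Mat n) (Mat n) ∘ₗ
    LinearMap.mulRight ℂ x.1.val) X
  have e : nabla1 F x = traceDual (D.toLinearMap ∘ₗ LinearMap.inl ℂ (Mat n) (Mat n) ∘ₗ
      LinearMap.mulRight ℂ x.1.val) := by
    unfold nabla1; congr 1; funext Y; exact (key Y).deriv
  rw [e, h]; exact key X

theorem nabla1'_spec {n : ℕ} {F : Phase n → ℂ} (hF : F ∈ Hol n) (x : Phase n) (X : Mat n) :
    HasDerivAt (fun z : ℂ => F (x.1 * expGL (z • X), x.2)) (trForm (nabla1' F x) X) 0 := by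
  obtain ⟨D, hD⟩ := hasDerivAt_curve hF x
  have key : ∀ Y : Mat n, HasDerivAt (fun z : ℂ => F (x.1 * expGL (z • Y), x.2))
      (D (x.1.val * Y, 0)) 0 := fun Y =>
    hD (fun z => (x.1 * expGL (z • Y), x.2)) _ _ (by simp [expGL_zero])
      ((hasDerivAt_expGL Y).const_mul x.1.val) (hasDerivAt_const _ _)
  have h := trForm_traceDual (D.toLinearMap ∘ₗ LinearMap.inl ℂ (Mat n) (Mat n) ∘ₗ
    LinearMap.mulLeft ℂ x.1.val) X
  have e : nabla1' F x = traceDual (D.toLinearMap ∘ₗ LinearMap.inl ℂ (Mat n) (Mat n) ∘ₗ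
      LinearMap.mulLeft ℂ x.1.val) := by
    unfold nabla1'; congr 1; funext Y; exact (key Y).deriv
  rw [e, h]; exact key X

theorem hasDerivAt_line {n : ℕ} (L Y : Mat n) :
    HasDerivAt (fun z : ℂ => L + z • Y) Y 0 := by
  have h := ((hasDerivAt_id (0 : ℂ)).smul_const Y).const_add L
  rw [one_smul] at h
  exact h

theorem d2_spec {n : ℕ} {F : Phase n → ℂ} (hF : F ∈ Hol n) (x : Phase n) (X : Mat n) :
    HasDerivAt (fun z : ℂ => F (x.1, x.2 + z • X)) (trForm (d2 F x) X) 0 := by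
  obtain ⟨D, hD⟩ := hasDerivAt_curve hF x
  have key : ∀ Y : Mat n, HasDerivAt (fun z : ℂ => F (x.1, x.2 + z • Y)) (D (0, Y)) 0 := fun Y =>
    hD (fun z => (x.1, x.2 + z • Y)) _ _ (by simp)
      (hasDerivAt_const (0 : ℂ) x.1.val) (hasDerivAt_line x.2 Y)
  have h := trForm_traceDual (D.toLinearMap ∘ₗ LinearMap.inr ℂ (Mat n) (Mat n)) X
  have e : d2 F x = traceDual (D.toLinearMap ∘ₗ LinearMap.inr ℂ (Mat n) (Mat n)) := by
    unfold d2; congr 1; funext Y; exact (key Y).deriv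
  rw [e, h]; exact key X

end DefiningRelations

end GLPoisson

/-! Identify the phase space with the open set of pairs (A, L), A invertible, in a complex vector
space. Each bracket then has the form df(X_h), with a Hamiltonian vector linear in the covector and
polynomial in the point. It is again holomorphic because derivatives of holomorphic functions are
(`DifferentiableOn.differentiableOn_fderiv`). In the Jacobi sum the second derivatives cancel by
their symmetry and by skewness of the bivector, and a pointwise identity, trilinear in the
covectors, remains (`IsPoissonField.jacobi`). So only skewness and this Schouten identity have to be
checked for each bracket.

The first field is linear in the point, and cyclicity of the trace suffices. For the second, the Lie
algebra of quadruples acts by left and right multiplications, `pair` is an invariant form on it, and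
`cov_act` turns covectors into moments; the field is `act (rho (mom x φ)) x`. The Schouten identity
becomes the vanishing of the cyclic sum of `pair ξ₁ ⁅rho ξ₂, rho ξ₃⁆` on moments. By the modified
Yang–Baxter equation for `r` (`r_mcybe`) this sum is -1/4 of `pair ξ₁ ⁅ξ₂, ξ₃⁆` (`pair_lie_rho`),
and that form vanishes on moments, since tr(XA[XB,XC]) = tr(AX[BX,CX]). -/

/-! ### Holomorphy of derivatives in several complex variables -/

section SeveralVariables

open Metric MeasureTheory

variable {E : Type*} [NormedAddCommGroup E] [NormedSpace ℂ E]

/-- **Cauchy estimate** for the Fréchet derivative. -/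
theorem DifferentiableOn.norm_fderiv_le_of_norm_le {f : E → ℂ} {c : E} {R M : ℝ} (hR : 0 < R)
    (hf : DifferentiableOn ℂ f (ball c R)) (hM : ∀ y ∈ ball c R, ‖f y‖ ≤ M) :
    ‖fderiv ℂ f c‖ ≤ 2 * M / R := by
  refine Complex.norm_fderiv_le_div_of_mapsTo_ball hf (fun y hy => ?_) hR
  -- The Schwarz lemma is applied around the value `f c`, where the image has radius at most 2M;
  -- hence the factor 2.
  rw [mem_closedBall, dist_eq_norm]
  have h1 := hM y hy
  have h2 := hM c (mem_ball_self hR)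
  linarith [norm_sub_le (f y) (f c)]

variable [FiniteDimensional ℂ E]

/-- The directional derivatives of a holomorphic function of several variables are holomorphic. -/
theorem DifferentiableOn.differentiableAt_fderiv_apply {f : E → ℂ} {U : Set E} (hU : IsOpen U)
    (hf : DifferentiableOn ℂ f U) (v : E) {x₀ : E} (hx₀ : x₀ ∈ U) :
    DifferentiableAt ℂ (fun x => fderiv ℂ f x v) x₀ := by
  have : ProperSpace E := FiniteDimensional.proper ℂ E
  have : ProperSpace (E →L[ℂ] ℂ) := FiniteDimensional.proper ℂ _
  obtain ⟨ε, hε, hεU⟩ := nhds_basis_closedBall.mem_iff.1 (hU.mem_nhds hx₀)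
  obtain ⟨M, hM⟩ := (isCompact_closedBall x₀ ε).exists_bound_of_continuousOn
    (hf.continuousOn.mono hεU)
  -- Points are shifted by at most 2δ from `x₀` and the Cauchy estimate needs a further δ; 3δ stays
  -- below ε. The `+ 1` in `R` below covers `v = 0`.
  set δ : ℝ := ε / 4 with hδ
  have hδ0 : 0 < δ := by positivity
  set R : ℝ := δ / (‖v‖ + 1) with hRdef
  have hv1 : 0 < ‖v‖ + 1 := by positivity
  have hR : 0 < R := by positivity
  have hRv : R * ‖v‖ ≤ δ := by
    rw [hRdef, div_mul_eq_mul_div, div_le_iff₀ hv1]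
    nlinarith [norm_nonneg v]
  have hshift : ∀ x ∈ ball x₀ δ, ∀ z : ℂ, ‖z‖ ≤ R → x + z • v ∈ closedBall x₀ (2 * δ) := by
    intro x hx z hz
    rw [mem_ball, dist_eq_norm] at hx
    rw [mem_closedBall, dist_eq_norm]
    have h1 : ‖z • v‖ ≤ δ := by
      rw [norm_smul]
      exact (mul_le_mul_of_nonneg_right hz (norm_nonneg v)).trans hRv
    calc ‖x + z • v - x₀‖ = ‖(x - x₀) + z • v‖ := by congr 1; abel
      _ ≤ ‖x - x₀‖ + ‖z • v‖ := norm_add_le _ _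
      _ ≤ 2 * δ := by linarith
  have hsubU : closedBall x₀ (2 * δ) ⊆ U :=
    (closedBall_subset_closedBall (by linarith)).trans hεU
  have hdiff : ∀ y ∈ closedBall x₀ (2 * δ), DifferentiableAt ℂ f y := fun y hy =>
    hf.differentiableAt (hU.mem_nhds (hsubU hy))
  have hbound : ∀ y ∈ closedBall x₀ (2 * δ), ‖fderiv ℂ f y‖ ≤ 2 * M / δ := by
    intro y hy
    have hsub : ball y δ ⊆ closedBall x₀ ε := by
      intro w hw
      rw [mem_ball] at hw
      rw [mem_closedBall] at hy ⊢
      linarith [dist_triangle w y x₀]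
    exact DifferentiableOn.norm_fderiv_le_of_norm_le hδ0 (hf.mono (hsub.trans hεU))
      fun w hw => hM w (hsub hw)
  have hcirc : ∀ θ : ℝ, ‖circleMap 0 R θ‖ ≤ R := fun θ => by simp [abs_of_pos hR]
  have hline : ∀ x ∈ ball x₀ δ, ∀ z ∈ closedBall (0 : ℂ) R,
      HasDerivAt (fun z : ℂ => f (x + z • v)) (fderiv ℂ f (x + z • v) v) z := by
    intro x hx z hz
    have h1 : HasDerivAt (fun z : ℂ => x + z • v) v z := by
      simpa using ((hasDerivAt_id z).smul_const v).const_add x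
    exact (hdiff _ (hshift x hx z (by simpa using hz))).hasFDerivAt.comp_hasDerivAt z h1
  -- The kernel dζ/ζ² of Cauchy's formula for the first derivative of z ↦ f(x + zv) at 0. In that
  -- formula `x` enters only through `f`, so one may differentiate under the integral.
  set w : ℝ → ℂ := fun θ => _root_.deriv (circleMap 0 R) θ * (circleMap 0 R θ ^ 2)⁻¹ with hw
  have hwc : Continuous w := by
    have h0 : ∀ θ, circleMap 0 R θ ^ 2 ≠ 0 := fun θ =>
      pow_ne_zero 2 (circleMap_ne_center hR.ne')
    have : Continuous (circleMap 0 R) := continuous_circleMap 0 R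
    simp only [hw, deriv_circleMap]
    exact (this.mul continuous_const).mul ((this.pow 2).inv₀ h0)
  have hcont : ∀ x ∈ ball x₀ δ, Continuous fun θ => w θ * f (x + circleMap 0 R θ • v) := by
    intro x hx
    refine hwc.mul (continuous_iff_continuousAt.2 fun θ => ?_)
    exact ContinuousAt.comp (f := fun θ => x + circleMap 0 R θ • v) (g := f)
      (hdiff _ (hshift x hx _ (hcirc θ))).continuousAt
      (continuous_const.add ((continuous_circleMap 0 R).smul continuous_const)).continuousAt
  have hcauchy : ∀ x ∈ ball x₀ δ, fderiv ℂ f x v = (2 * Real.pi * Complex.I : ℂ)⁻¹ *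
      ∫ θ in (0 : ℝ)..2 * Real.pi, w θ * f (x + circleMap 0 R θ • v) := by
    intro x hx
    have hx' : x ∈ closedBall x₀ (2 * δ) := by simpa using hshift x hx 0 (by simpa using hR.le)
    have hopen : IsOpen ((fun z : ℂ => x + z • v) ⁻¹' U) :=
      hU.preimage (by fun_prop)
    have hd : DifferentiableOn ℂ (fun z : ℂ => f (x + z • v)) ((fun z : ℂ => x + z • v) ⁻¹' U) :=
      hf.comp (by fun_prop) (fun z hz => hz)
    have h := Complex.two_pi_I_inv_smul_circleIntegral_sub_sq_inv_smul_of_differentiable hopen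
      (fun z hz => hsubU (hshift x hx z (mem_closedBall_zero_iff.1 hz))) hd (mem_ball_self hR)
    have h0 := (hline x hx 0 (by simpa using hR.le)).deriv
    rw [zero_smul, add_zero] at h0
    rw [← h0, ← h]
    simp only [circleIntegral, hw, smul_eq_mul, sub_zero, mul_assoc]
  -- Continuity of the derivative is not yet available; measurability of `fderiv` is enough.
  have hmeas : AEStronglyMeasurable
      (fun θ => w θ • fderiv ℂ f (x₀ + circleMap 0 R θ • v))
      (volume.restrict (Set.uIoc 0 (2 * Real.pi))) := by
    borelize E
    borelize (E →L[ℂ] ℂ)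
    refine hwc.aestronglyMeasurable.smul ?_
    have : Measurable fun θ => fderiv ℂ f (x₀ + circleMap 0 R θ • v) :=
      (measurable_fderiv ℂ f).comp
        (continuous_const.add ((continuous_circleMap 0 R).smul continuous_const)).measurable
    exact this.aestronglyMeasurable
  have hball : ball x₀ δ ∈ nhds x₀ := ball_mem_nhds x₀ hδ0
  have key := intervalIntegral.hasFDerivAt_integral_of_dominated_of_fderiv_le
    (𝕜 := ℂ) (μ := volume) (a := 0) (b := 2 * Real.pi)
    (F := fun x θ => w θ * f (x + circleMap 0 R θ • v))
    (F' := fun x θ => w θ • fderiv ℂ f (x + circleMap 0 R θ • v))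
    (bound := fun θ => ‖w θ‖ * (2 * M / δ)) hball
    (Filter.eventually_of_mem hball fun x hx => (hcont x hx).aestronglyMeasurable)
    ((hcont x₀ (mem_ball_self hδ0)).intervalIntegrable _ _) hmeas
    (Filter.Eventually.of_forall fun θ _ x hx => by
      rw [norm_smul]
      exact mul_le_mul_of_nonneg_left (hbound _ (hshift x hx _ (hcirc θ))) (norm_nonneg _))
    ((hwc.norm.mul continuous_const).intervalIntegrable _ _)
    (Filter.Eventually.of_forall fun θ _ x hx => by
      have h1 : HasFDerivAt (fun x => x + circleMap 0 R θ • v) (ContinuousLinearMap.id ℂ E) x :=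
        (hasFDerivAt_id x).add_const _
      have h2 := (hdiff _ (hshift x hx _ (hcirc θ))).hasFDerivAt.comp x h1
      rw [ContinuousLinearMap.comp_id] at h2
      exact h2.const_mul (w θ))
  refine (key.differentiableAt.const_mul (2 * Real.pi * Complex.I : ℂ)⁻¹).congr_of_eventuallyEq ?_
  exact Filter.eventually_of_mem hball hcauchy

/-- The derivative of a holomorphic function of several variables is holomorphic. -/
theorem DifferentiableOn.differentiableOn_fderiv {f : E → ℂ} {U : Set E} (hU : IsOpen U)
    (hf : DifferentiableOn ℂ f U) : DifferentiableOn ℂ (fderiv ℂ f) U := by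
  intro x hx
  refine DifferentiableAt.differentiableWithinAt ?_
  let b := Module.finBasis ℂ E
  have e : fderiv ℂ f = fun x => ∑ i, fderiv ℂ f x (b i) •
      LinearMap.toContinuousLinearMap (b.coord i) := by
    funext y
    ext u
    conv_lhs => rw [← b.sum_repr u, map_sum]
    simp [mul_comm]
  rw [e]
  exact DifferentiableAt.fun_sum fun i _ =>
    (hf.differentiableAt_fderiv_apply hU (b i) hx).smul_const _

end SeveralVariables

/-! ### Hamiltonian brackets and the Jacobi identity -/

section HamiltonianBracket

variable {E : Type*} [NormedAddCommGroup E] [NormedSpace ℂ E]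

/-- The bracket `{f, h} = df (X_h)`, where `X x φ` is the Hamiltonian vector at `x` of a function
with differential `φ`. -/
noncomputable def hamBracket (X : E → (E →L[ℂ] ℂ) → E) (f h : E → ℂ) (x : E) : ℂ :=
  fderiv ℂ f x (X x (fderiv ℂ h x))

theorem hamBracket_add_left {X : E → (E →L[ℂ] ℂ) → E} {f f' h : E → ℂ} {x : E}
    (hf : DifferentiableAt ℂ f x) (hf' : DifferentiableAt ℂ f' x) :
    hamBracket X (fun y => f y + f' y) h x = hamBracket X f h x + hamBracket X f' h x := by
  rw [hamBracket, fderiv_fun_add hf hf']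
  rfl

theorem hamBracket_smul_left {X : E → (E →L[ℂ] ℂ) → E} {f h : E → ℂ} {x : E} (c : ℂ)
    (hf : DifferentiableAt ℂ f x) :
    hamBracket X (fun y => c • f y) h x = c • hamBracket X f h x := by
  rw [hamBracket, fderiv_fun_const_smul hf]
  rfl

theorem hamBracket_mul_left {X : E → (E →L[ℂ] ℂ) → E} {f f' h : E → ℂ} {x : E}
    (hf : DifferentiableAt ℂ f x) (hf' : DifferentiableAt ℂ f' x) :
    hamBracket X (fun y => f y * f' y) h x
      = f x * hamBracket X f' h x + hamBracket X f h x * f' x := by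
  rw [hamBracket, fderiv_fun_mul hf hf']
  simp [hamBracket, mul_comm]

/-- The conditions on a family of Hamiltonian vectors under which `hamBracket X` is a Poisson
bracket: `X` is linear in the covector and holomorphic with derivative `dX x v` at `x` in the
direction `v`, the associated
bivector is antisymmetric, and its Schouten bracket with itself vanishes. -/
structure IsPoissonField (X : E → (E →L[ℂ] ℂ) → E) (dX : E → E → (E →L[ℂ] ℂ) → E) :
    Prop where
  map_add : ∀ x φ ψ, X x (φ + ψ) = X x φ + X x ψ
  map_smul : ∀ x (c : ℂ) φ, X x (c • φ) = c • X x φ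
  differentiable : Differentiable ℂ fun q : E × (E →L[ℂ] ℂ) => X q.1 q.2
  hasDerivAt : ∀ x v φ, HasDerivAt (fun z : ℂ => X (x + z • v) φ) (dX x v φ) 0
  skew : ∀ x (φ ψ : E →L[ℂ] ℂ), φ (X x ψ) = -ψ (X x φ)
  schouten : ∀ x (φ ψ χ : E →L[ℂ] ℂ),
    φ (dX x (X x χ) ψ) + ψ (dX x (X x φ) χ) + χ (dX x (X x ψ) φ) = 0

namespace IsPoissonField

variable {X : E → (E →L[ℂ] ℂ) → E} {dX : E → E → (E →L[ℂ] ℂ) → E}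

/-- Joint differentiability is part of the assumptions, so the total derivative is determined by its
values along the two coordinate directions; in the covector direction linearity gives `X x ψ`. -/
theorem fderiv_apply (hX : IsPoissonField X dX) (x v : E) (φ ψ : E →L[ℂ] ℂ) :
    fderiv ℂ (fun q : E × (E →L[ℂ] ℂ) => X q.1 q.2) (x, φ) (v, ψ) = dX x v φ + X x ψ := by
  have hd := (hX.differentiable (x, φ)).hasFDerivAt
  set D := fderiv ℂ (fun q : E × (E →L[ℂ] ℂ) => X q.1 q.2) (x, φ)
  have hline : ∀ y u : E, HasDerivAt (fun z : ℂ => y + z • u) u 0 := fun y u => by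
    simpa using ((hasDerivAt_id (0 : ℂ)).smul_const u).const_add y
  have h1 : D (v, 0) = dX x v φ := by
    have hc : HasDerivAt (fun z : ℂ => (x + z • v, φ)) (v, (0 : E →L[ℂ] ℂ)) 0 :=
      (hline x v).prodMk (hasDerivAt_const _ _)
    exact (HasFDerivAt.comp_hasDerivAt (0 : ℂ) (l := fun q : E × (E →L[ℂ] ℂ) => X q.1 q.2)
      (f := fun z : ℂ => (x + z • v, φ)) (l' := D) (by simpa using hd) hc).unique (hX.hasDerivAt x v φ)
  have h2 : D (0, ψ) = X x ψ := by
    have hc : HasDerivAt (fun z : ℂ => (x, φ + z • ψ)) ((0 : E), ψ) 0 :=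
      (hasDerivAt_const _ _).prodMk
        (by simpa using ((hasDerivAt_id (0 : ℂ)).smul_const ψ).const_add φ)
    have h3 := HasFDerivAt.comp_hasDerivAt (0 : ℂ)
      (l := fun q : E × (E →L[ℂ] ℂ) => X q.1 q.2) (f := fun z : ℂ => (x, φ + z • ψ)) (l' := D)
      (by rw [show φ + (0 : ℂ) • ψ = φ by ext; simp]; exact hd) hc
    have h4 : HasDerivAt (fun z : ℂ => X x φ + z • X x ψ) (X x ψ) 0 := hline _ _
    refine h3.unique ?_
    simpa [Function.comp_def, hX.map_add, hX.map_smul] using h4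
  rw [← h1, ← h2, ← _root_.map_add]
  simp

variable [FiniteDimensional ℂ E] {U : Set E} {f h k : E → ℂ}

theorem differentiableOn (hX : IsPoissonField X dX) (hU : IsOpen U)
    (hf : DifferentiableOn ℂ f U) (hh : DifferentiableOn ℂ h U) :
    DifferentiableOn ℂ (hamBracket X f h) U :=
  (hf.differentiableOn_fderiv hU).clm_apply
    (hX.differentiable.comp_differentiableOn
      (differentiableOn_id.prodMk (hh.differentiableOn_fderiv hU)))

/-- The product rule produces df(X(D²h v)); skewness rewrites it as -D²h(v, X_f), so that both
second derivatives are evaluated on Hamiltonian vectors and can cancel in the Jacobi sum. -/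
theorem fderiv_hamBracket (hX : IsPoissonField X dX) (hU : IsOpen U)
    (hf : DifferentiableOn ℂ f U) (hh : DifferentiableOn ℂ h U) {x : E} (hx : x ∈ U) (v : E) :
    fderiv ℂ (hamBracket X f h) x v =
      fderiv ℂ (fderiv ℂ f) x v (X x (fderiv ℂ h x))
        - fderiv ℂ (fderiv ℂ h) x v (X x (fderiv ℂ f x))
        + fderiv ℂ f x (dX x v (fderiv ℂ h x)) := by
  have h1 := ((hf.differentiableOn_fderiv hU).differentiableAt (hU.mem_nhds hx)).hasFDerivAt
  have h2 := ((hh.differentiableOn_fderiv hU).differentiableAt (hU.mem_nhds hx)).hasFDerivAt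
  have h3 := (hX.differentiable (x, fderiv ℂ h x)).hasFDerivAt.comp x
    ((hasFDerivAt_id x).prodMk h2)
  have h4 := (h1.clm_apply h3).fderiv
  have h5 : fderiv ℂ (hamBracket X f h) x v = _ := congrArg (fun T : E →L[ℂ] ℂ => T v) h4
  rw [h5]
  simp [hX.fderiv_apply, hX.skew x (fderiv ℂ f x) (fderiv ℂ (fderiv ℂ h) x v)]
  ring

theorem fderiv_fderiv_comm (hU : IsOpen U) (hf : DifferentiableOn ℂ f U) {x : E} (hx : x ∈ U)
    (v w : E) : fderiv ℂ (fderiv ℂ f) x v w = fderiv ℂ (fderiv ℂ f) x w v :=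
  second_derivative_symmetric_of_eventually (𝕜 := ℂ)
    (Filter.eventually_of_mem (hU.mem_nhds hx) fun _ hy =>
      (hf.differentiableAt (hU.mem_nhds hy)).hasFDerivAt)
    ((hf.differentiableOn_fderiv hU).differentiableAt (hU.mem_nhds hx)).hasFDerivAt v w

theorem jacobi (hX : IsPoissonField X dX) (hU : IsOpen U) (hf : DifferentiableOn ℂ f U)
    (hh : DifferentiableOn ℂ h U) (hk : DifferentiableOn ℂ k U) {x : E} (hx : x ∈ U) :
    hamBracket X (hamBracket X f h) k x + hamBracket X (hamBracket X h k) f x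
      + hamBracket X (hamBracket X k f) h x = 0 := by
  -- Each Hessian occurs twice with opposite signs, for instance D²f(X_k, X_h) and -D²f(X_h, X_k);
  -- symmetry cancels them and leaves the Schouten expression.
  rw [hamBracket, hamBracket, hamBracket, hX.fderiv_hamBracket hU hf hh hx,
    hX.fderiv_hamBracket hU hh hk hx, hX.fderiv_hamBracket hU hk hf hx,
    fderiv_fderiv_comm hU hf hx (X x (fderiv ℂ k x)),
    fderiv_fderiv_comm hU hh hx (X x (fderiv ℂ k x)),
    fderiv_fderiv_comm hU hk hx (X x (fderiv ℂ h x))]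
  linear_combination hX.schouten x (fderiv ℂ f x) (fderiv ℂ h x) (fderiv ℂ k x)

end IsPoissonField

end HamiltonianBracket

namespace GLPoisson

variable {n : ℕ}

/-! ### The trace form and the modified Yang–Baxter equation for `r` -/

section TraceForm

theorem trForm_comm (X Y : Mat n) : trForm X Y = trForm Y X := Matrix.trace_mul_comm X Y

theorem trForm_single (X : Mat n) (i j : Fin n) : trForm X (Matrix.single j i 1) = X i j := by
  simp [trForm, Matrix.trace_mul_single]

end TraceForm

section RMatrix

theorem r_apply (X : Mat n) (i j : Fin n) :
    r X i j = (1 / 2 : ℂ) * ((if i < j then X i j else 0) - if j < i then X i j else 0) := by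
  simp [r, upper, lower]

/-- The `r`-matrix as a linear map. -/
noncomputable def rLin : Mat n →ₗ[ℂ] Mat n where
  toFun := r
  map_add' X Y := by
    ext i j
    simp only [r_apply, Matrix.add_apply]
    split_ifs <;> ring
  map_smul' c X := by
    ext i j
    simp only [r_apply, Matrix.smul_apply, RingHom.id_apply, smul_eq_mul]
    split_ifs <;> ring

theorem r_add (X Y : Mat n) : r (X + Y) = r X + r Y := rLin.map_add X Y

theorem r_sub (X Y : Mat n) : r (X - Y) = r X - r Y := rLin.map_sub X Y

theorem r_smul (c : ℂ) (X : Mat n) : r (c • X) = c • r X := rLin.map_smul c X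

/-- The `r`-matrix is antisymmetric with respect to the trace form. -/
theorem trForm_r (X Y : Mat n) : trForm X (r Y) = -trForm Y (r X) := by
  simp only [trForm, Matrix.trace, Matrix.diag, Matrix.mul_apply, r_apply]
  rw [Finset.sum_comm, ← Finset.sum_neg_distrib]
  refine Finset.sum_congr rfl fun i _ => ?_
  rw [← Finset.sum_neg_distrib]
  refine Finset.sum_congr rfl fun j _ => ?_
  split_ifs <;> ring

/-- The diagonal part of a matrix. -/
def diagPart (X : Mat n) : Mat n := Matrix.diagonal X.diag

theorem eq_upper_add_diagPart_add_lower (X : Mat n) : X = upper X + diagPart X + lower X := by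
  ext i j
  rcases lt_trichotomy i j with h | h | h
  · simp [upper, lower, diagPart, h, h.ne, h.not_gt]
  · simp [upper, lower, diagPart, h]
  · simp [upper, lower, diagPart, h, h.ne', h.not_gt]

theorem r_eq_half_smul {X : Mat n} (hX : ∀ i j, j ≤ i → X i j = 0) : r X = (1 / 2 : ℂ) • X := by
  ext i j
  rw [r_apply, Matrix.smul_apply, smul_eq_mul]
  rcases lt_or_ge i j with h | h
  · simp [h, h.not_gt]
  · simp [hX i j h]

theorem r_eq_neg_half_smul {X : Mat n} (hX : ∀ i j, i ≤ j → X i j = 0) :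
    r X = (-1 / 2 : ℂ) • X := by
  ext i j
  rw [r_apply, Matrix.smul_apply, smul_eq_mul]
  rcases lt_or_ge j i with h | h
  · simp [h, h.not_gt]; ring
  · simp [hX i j h]

/-- A product of upper triangular matrices is strictly upper triangular once one factor has zero
diagonal, and `r` is 1/2 on strictly upper triangular matrices. -/
theorem r_mul_of_upper {X Y : Mat n} (hX : ∀ i j, j < i → X i j = 0)
    (hY : ∀ i j, j < i → Y i j = 0)
    (hXY : (∀ i, X i i = 0) ∨ ∀ i, Y i i = 0) : r (X * Y) = (1 / 2 : ℂ) • (X * Y) := by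
  refine r_eq_half_smul fun i j hij => ?_
  rw [Matrix.mul_apply]
  refine Finset.sum_eq_zero fun k _ => ?_
  rcases lt_or_ge k i with h | h
  · rw [hX i k h, zero_mul]
  rcases lt_or_ge j k with h' | h'
  · rw [hY k j h', mul_zero]
  obtain rfl : i = k := le_antisymm h (h'.trans hij)
  obtain rfl : i = j := le_antisymm h' hij
  rcases hXY with h0 | h0 <;> simp [h0]

theorem r_mul_of_lower {X Y : Mat n} (hX : ∀ i j, i < j → X i j = 0)
    (hY : ∀ i j, i < j → Y i j = 0)
    (hXY : (∀ i, X i i = 0) ∨ ∀ i, Y i i = 0) : r (X * Y) = (-1 / 2 : ℂ) • (X * Y) := by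
  refine r_eq_neg_half_smul fun i j hij => ?_
  rw [Matrix.mul_apply]
  refine Finset.sum_eq_zero fun k _ => ?_
  rcases lt_or_ge i k with h | h
  · rw [hX i k h, zero_mul]
  rcases lt_or_ge k j with h' | h'
  · rw [hY k j h', mul_zero]
  obtain rfl : k = i := le_antisymm h (hij.trans h')
  obtain rfl : k = j := le_antisymm (hij) h'
  rcases hXY with h0 | h0 <;> simp [h0]

/-- The modified classical Yang–Baxter equation. -/
theorem r_mcybe (X Y : Mat n) :
    ⁅r X, r Y⁆ = r (⁅r X, Y⁆ + ⁅X, r Y⁆) - (1 / 4 : ℂ) • ⁅X, Y⁆ := by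
  have hU : ∀ Z : Mat n, ∀ i j, j < i → upper Z i j = 0 := fun Z i j h => by
    simp [upper, h.not_gt]
  have hL : ∀ Z : Mat n, ∀ i j, i < j → lower Z i j = 0 := fun Z i j h => by
    simp [lower, h.not_gt]
  have hU0 : ∀ (Z : Mat n) i, upper Z i i = 0 := fun Z i => by simp [upper]
  have hL0 : ∀ (Z : Mat n) i, lower Z i i = 0 := fun Z i => by simp [lower]
  have hDU : ∀ Z : Mat n, ∀ i j, j < i → diagPart Z i j = 0 := fun Z i j h => by
    simp [diagPart, h.ne']
  have hDL : ∀ Z : Mat n, ∀ i j, i < j → diagPart Z i j = 0 := fun Z i j h => by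
    simp [diagPart, h.ne]
  have hDD : diagPart X * diagPart Y = diagPart Y * diagPart X := by
    simp [diagPart, mul_comm]
  have rUU := fun Z W : Mat n => r_mul_of_upper (hU Z) (hU W) (Or.inl (hU0 Z))
  have rUD := fun Z W : Mat n => r_mul_of_upper (hU Z) (hDU W) (Or.inl (hU0 Z))
  have rDU := fun Z W : Mat n => r_mul_of_upper (hDU Z) (hU W) (Or.inr (hU0 W))
  have rLL := fun Z W : Mat n => r_mul_of_lower (hL Z) (hL W) (Or.inl (hL0 Z))
  have rLD := fun Z W : Mat n => r_mul_of_lower (hL Z) (hDL W) (Or.inl (hL0 Z))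
  have rDL := fun Z W : Mat n => r_mul_of_lower (hDL Z) (hL W) (Or.inr (hL0 W))
  have hX : X = upper X + diagPart X + lower X := eq_upper_add_diagPart_add_lower X
  have hY : Y = upper Y + diagPart Y + lower Y := eq_upper_add_diagPart_add_lower Y
  have rX : r X = (1 / 2 : ℂ) • (upper X - lower X) := rfl
  have rY : r Y = (1 / 2 : ℂ) • (upper Y - lower Y) := rfl
  have rUU₁ := rUU X Y; have rUU₂ := rUU Y X
  have rUD₁ := rUD X Y; have rUD₂ := rUD Y X
  have rDU₁ := rDU X Y; have rDU₂ := rDU Y X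
  have rLL₁ := rLL X Y; have rLL₂ := rLL Y X
  have rLD₁ := rLD X Y; have rLD₂ := rLD Y X
  have rDL₁ := rDL X Y; have rDL₂ := rDL Y X
  clear rUU rUD rDU rLL rLD rDL hU hL hU0 hL0 hDU hDL
  generalize upper X = u, diagPart X = d, lower X = l at *
  generalize upper Y = u', diagPart Y = d', lower Y = l' at *
  -- The mixed products of an upper and a lower part, on which `r` has no simple value, cancel here.
  -- Every surviving product is strictly triangular. The diagonal commutator in `⁅X, Y⁆` is removed
  -- at the end by `hDD`.
  have e : ⁅r X, Y⁆ + ⁅X, r Y⁆ = u * u' - u' * u - (l * l' - l' * l)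
      + (1 / 2 : ℂ) • (u * d' - d' * u + (d * u' - u' * d)
        - (l * d' - d' * l) - (d * l' - l' * d)) := by
    rw [rX, rY, hX, hY, Ring.lie_def, Ring.lie_def]
    simp only [mul_add, add_mul, mul_sub, sub_mul, smul_mul_assoc, mul_smul_comm]
    module
  rw [e]
  simp only [r_add, r_sub, r_smul, rUU₁, rUU₂, rUD₁, rUD₂, rDU₁, rDU₂, rLL₁, rLL₂, rLD₁, rLD₂,
    rDL₁, rDL₂]
  rw [rX, rY, hX, hY, Ring.lie_def, Ring.lie_def]
  simp only [mul_add, add_mul, mul_sub, sub_mul, smul_mul_assoc, mul_smul_comm, hDD]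
  module

end RMatrix

/-! ### The operator `rho` on quadruples and its Yang–Baxter identity -/

section Double

theorem trForm_lie_rotate (X Y Z : Mat n) : trForm X ⁅Y, Z⁆ = trForm Z ⁅X, Y⁆ := by
  simp only [trForm, Ring.lie_def, mul_sub, Matrix.trace_sub]
  rw [Matrix.trace_mul_cycle' X Y Z, Matrix.trace_mul_cycle' X Z Y, Matrix.trace_mul_cycle' Y X Z]

/-- The trilinear form of the modified Yang–Baxter equation. -/
theorem trForm_lie_r (X Y Z : Mat n) :
    trForm X ⁅r Y, r Z⁆ + trForm (r X) ⁅Y, r Z⁆ + trForm (r X) ⁅r Y, Z⁆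
      = -(1 / 4) * trForm X ⁅Y, Z⁆ := by
  have h1 : trForm X ⁅r Y, r Z⁆
      = -trForm (⁅r Y, Z⁆ + ⁅Y, r Z⁆) (r X) - (1 / 4) * trForm X ⁅Y, Z⁆ := by
    rw [r_mcybe, ← trForm_r]
    simp [trForm, mul_sub]
  rw [h1, trForm_comm _ (r X)]
  simp only [trForm, mul_add, Matrix.trace_add]
  ring

/-- Quadruples of matrices, the Lie algebra acting on `gl(n, ℂ) × gl(n, ℂ)` by left and right
multiplications in both factors. -/
abbrev Quad (n : ℕ) : Type := Mat n × Mat n × Mat n × Mat n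

/-- The invariant bilinear form of neutral signature on quadruples. -/
def pair (ξ η : Quad n) : ℂ :=
  trForm ξ.1 η.1 - trForm ξ.2.1 η.2.1 + trForm ξ.2.2.1 η.2.2.1 - trForm ξ.2.2.2 η.2.2.2

/-- The antisymmetric operator on quadruples defining the second bracket. -/
noncomputable def rho (ξ : Quad n) : Quad n :=
  let y := -r (ξ.1 + ξ.2.2.1 - ξ.2.2.2)
  (y + (1 / 2 : ℂ) • (ξ.2.2.1 + ξ.2.2.2), -r ξ.2.1, y + (1 / 2 : ℂ) • (ξ.2.2.2 - ξ.1),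
    y + (1 / 2 : ℂ) • (ξ.2.2.1 + ξ.1))

/-- The common term y in three slots pairs with ξ as the trace of (a + b - b')y, so the `r`-terms
are skew because `r` is; the terms with coefficient 1/2 are skew by symmetry of the trace form. -/
theorem pair_rho (ξ η : Quad n) : pair ξ (rho η) = -pair η (rho ξ) := by
  obtain ⟨a, a', b, b'⟩ := ξ
  obtain ⟨c, c', d, d'⟩ := η
  have h1 := trForm_r (a + b - b') (c + d - d')
  have h2 := trForm_r a' c'
  simp only [pair, rho]
  generalize r (a + b - b') = y at *
  generalize r (c + d - d') = z at *
  have c1 := trForm_comm a d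
  have c2 := trForm_comm a d'
  have c3 := trForm_comm b c
  have c4 := trForm_comm b' c
  have c5 := trForm_comm b d'
  have c6 := trForm_comm b' d
  simp only [trForm, mul_add, add_mul, mul_sub, sub_mul, mul_neg, mul_smul_comm,
    Matrix.trace_add, Matrix.trace_sub, Matrix.trace_neg, Matrix.trace_smul, smul_eq_mul] at *
  linear_combination -h1 + h2 + (1 / 2) * (c1 + c2 - c3 - c4 + c5 - c6)

theorem pair_lie_rotate (ξ η ζ : Quad n) : pair ξ ⁅η, ζ⁆ = pair ζ ⁅ξ, η⁆ :=
  congrArg₂ (· - ·) (congrArg₂ (· + ·) (congrArg₂ (· - ·) (trForm_lie_rotate _ _ _)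
    (trForm_lie_rotate _ _ _)) (trForm_lie_rotate _ _ _)) (trForm_lie_rotate _ _ _)

/-- The Yang–Baxter identities for the combinations a + b - b' and for a' reduce the cyclic sum to
-1/4 of `pair ξ₁ ⁅ξ₂, ξ₃⁆`, which `ha` and `hb` make zero. The components enter through equations so
that moments stay folded in the conclusion, ready for `cov_act`. -/
theorem pair_lie_rho {a₁ a₁' b₁ b₁' a₂ a₂' b₂ b₂' a₃ a₃' b₃ b₃' : Mat n}
    (ha : trForm a₁ ⁅a₂, a₃⁆ = trForm a₁' ⁅a₂', a₃'⁆)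
    (hb : trForm b₁ ⁅b₂, b₃⁆ = trForm b₁' ⁅b₂', b₃'⁆)
    {ξ₁ ξ₂ ξ₃ : Quad n} (h₁ : ξ₁ = (a₁, a₁', b₁, b₁')) (h₂ : ξ₂ = (a₂, a₂', b₂, b₂'))
    (h₃ : ξ₃ = (a₃, a₃', b₃, b₃')) :
    pair ξ₁ ⁅rho ξ₂, rho ξ₃⁆ + pair ξ₂ ⁅rho ξ₃, rho ξ₁⁆ + pair ξ₃ ⁅rho ξ₁, rho ξ₂⁆ = 0 := by
  have hl : ∀ ξ η : Quad n, ⁅ξ, η⁆ =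
      (⁅ξ.1, η.1⁆, ⁅ξ.2.1, η.2.1⁆, ⁅ξ.2.2.1, η.2.2.1⁆, ⁅ξ.2.2.2, η.2.2.2⁆) := fun _ _ => rfl
  have k1 := trForm_lie_r (a₁ + b₁ - b₁') (a₂ + b₂ - b₂') (a₃ + b₃ - b₃')
  have k2 := trForm_lie_r a₁' a₂' a₃'
  -- Invariance puts all three terms in the index order 1, 2, 3, so that their traces are the same
  -- words as in `k1` and `k2`.
  rw [pair_lie_rotate ξ₂, pair_lie_rotate ξ₃, pair_lie_rotate (rho ξ₂)]
  subst h₁ h₂ h₃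
  simp only [pair, rho, hl]
  generalize r (a₁ + b₁ - b₁') = y₁ at *
  generalize r (a₂ + b₂ - b₂') = y₂ at *
  generalize r (a₃ + b₃ - b₃') = y₃ at *
  generalize r a₁' = z₁, r a₂' = z₂, r a₃' = z₃ at *
  simp only [trForm, Ring.lie_def, mul_add, add_mul, mul_sub, sub_mul, mul_neg, neg_mul,
    smul_add, smul_sub, smul_neg, mul_smul_comm, smul_mul_assoc,
    Matrix.trace_add, Matrix.trace_sub, Matrix.trace_neg, Matrix.trace_smul, smul_eq_mul] at *
  linear_combination k1 - k2 - (1 / 4) * ha - (1 / 4) * hb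

end Double

/-! ### Covectors and their gradients -/

section Fields

attribute [local instance] Matrix.linftyOpNormedRing Matrix.linftyOpNormedAlgebra

/-- Complex linear forms on `gl(n, ℂ) × gl(n, ℂ)`. -/
abbrev Cov (n : ℕ) : Type := Mat n × Mat n →L[ℂ] ℂ

/-- The gradient, with respect to the trace form, of a linear form in the first variable. -/
noncomputable def grad₁ : Cov n →ₗ[ℂ] Mat n where
  toFun φ := traceDual fun X => φ (X, 0)
  map_add' _ _ := rfl
  map_smul' _ _ := rfl

/-- The gradient, with respect to the trace form, of a linear form in the second variable. -/
noncomputable def grad₂ : Cov n →ₗ[ℂ] Mat n where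
  toFun φ := traceDual fun X => φ (0, X)
  map_add' _ _ := rfl
  map_smul' _ _ := rfl

theorem trForm_grad₁ (φ : Cov n) (X : Mat n) : trForm (grad₁ φ) X = φ (X, 0) :=
  trForm_traceDual (φ.toLinearMap ∘ₗ LinearMap.inl ℂ (Mat n) (Mat n)) X

theorem trForm_grad₂ (φ : Cov n) (X : Mat n) : trForm (grad₂ φ) X = φ (0, X) :=
  trForm_traceDual (φ.toLinearMap ∘ₗ LinearMap.inr ℂ (Mat n) (Mat n)) X

theorem cov_apply (φ : Cov n) (x : Mat n × Mat n) :
    φ x = trForm (grad₁ φ) x.1 + trForm (grad₂ φ) x.2 := by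
  rw [trForm_grad₁, trForm_grad₂, ← map_add]
  simp

theorem differentiable_grad₁ : Differentiable ℂ (grad₁ : Cov n → Mat n) :=
  (LinearMap.toContinuousLinearMap (grad₁ (n := n))).differentiable

theorem differentiable_grad₂ : Differentiable ℂ (grad₂ : Cov n → Mat n) :=
  (LinearMap.toContinuousLinearMap (grad₂ (n := n))).differentiable

theorem differentiable_r : Differentiable ℂ (r : Mat n → Mat n) :=
  (LinearMap.toContinuousLinearMap (rLin (n := n))).differentiable

/-- A curve that is quadratic in the parameter has the linear coefficient as its derivative. -/
theorem hasDerivAt_quadratic {E : Type*} [NormedAddCommGroup E] [NormedSpace ℂ E] (A B C : E) :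
    HasDerivAt (fun z : ℂ => A + z • B + z ^ 2 • C) B 0 := by
  have h1 := ((hasDerivAt_id (0 : ℂ)).smul_const B).const_add A
  have h2 := ((hasDerivAt_id (0 : ℂ)).pow 2).smul_const C
  exact (h1.add h2).congr_deriv (by simp)

/-! ### The Poisson field of the first bracket -/

/-- The Hamiltonian vector fields of the first bracket. -/
noncomputable def field1 (x : Mat n × Mat n) (φ : Cov n) : Mat n × Mat n :=
  (grad₂ φ * x.1, ⁅grad₂ φ, x.2⁆ - x.1 * grad₁ φ)

/-- The derivative of `field1` along a vector. -/
noncomputable def dfield1 (_ v : Mat n × Mat n) (φ : Cov n) : Mat n × Mat n :=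
  (grad₂ φ * v.1, ⁅grad₂ φ, v.2⁆ - v.1 * grad₁ φ)

theorem field1_add (x : Mat n × Mat n) (φ ψ : Cov n) :
    field1 x (φ + ψ) = field1 x φ + field1 x ψ := by
  ext1 <;> simp [field1, Ring.lie_def, add_mul, mul_add]
  abel

theorem field1_smul (x : Mat n × Mat n) (c : ℂ) (φ : Cov n) :
    field1 x (c • φ) = c • field1 x φ := by
  ext1 <;> simp [field1, Ring.lie_def, smul_sub]

theorem field1_line (x v : Mat n × Mat n) (φ : Cov n) (z : ℂ) :
    field1 (x + z • v) φ = field1 x φ + z • dfield1 x v φ + z ^ 2 • 0 := by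
  ext1 <;> simp [field1, dfield1, Ring.lie_def, add_mul, mul_add, smul_sub]
  abel

theorem field1_skew (x : Mat n × Mat n) (φ ψ : Cov n) : φ (field1 x ψ) = -ψ (field1 x φ) := by
  rw [cov_apply φ, cov_apply ψ]
  simp only [field1, Ring.lie_def, trForm, mul_sub, Matrix.trace_sub]
  have h1 := (Matrix.trace_mul_cycle' (grad₁ φ) (grad₂ ψ) x.1).trans
    (Matrix.trace_mul_cycle' _ _ _)
  have h2 := (Matrix.trace_mul_cycle' (grad₂ φ) (grad₂ ψ) x.2).trans
    (Matrix.trace_mul_cycle' _ _ _)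
  have h3 := Matrix.trace_mul_cycle' (grad₂ φ) x.2 (grad₂ ψ)
  have h4 := Matrix.trace_mul_cycle' (grad₂ φ) x.1 (grad₁ ψ)
  linear_combination h1 + h2 - h3 - h4

theorem field1_schouten (x : Mat n × Mat n) (φ ψ χ : Cov n) :
    φ (dfield1 x (field1 x χ) ψ) + ψ (dfield1 x (field1 x φ) χ)
      + χ (dfield1 x (field1 x ψ) φ) = 0 := by
  rw [cov_apply φ, cov_apply ψ, cov_apply χ]
  simp only [field1, dfield1, Ring.lie_def, trForm, mul_sub, sub_mul, Matrix.trace_sub, mul_assoc]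
  -- Cyclic rotations that bring the base point to the front of each word; in this normal form the
  -- sum cancels term by term.
  have w₁ : ∀ A B C X : Mat n, (A * (X * (B * C))).trace = (X * (B * (C * A))).trace :=
    fun A B C X => by rw [Matrix.trace_mul_comm]; simp only [mul_assoc]
  have w₂ : ∀ A B C X : Mat n, (A * (B * (X * C))).trace = (X * (C * (A * B))).trace :=
    fun A B C X => by rw [← mul_assoc, Matrix.trace_mul_comm]; simp only [mul_assoc]
  have w₃ : ∀ A B C X : Mat n, (A * (B * (C * X))).trace = (X * (A * (B * C))).trace :=
    fun A B C X => by rw [← mul_assoc, ← mul_assoc, Matrix.trace_mul_comm]; simp only [mul_assoc]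
  simp only [w₁ _ _ _ x.1, w₂ _ _ _ x.1, w₃ _ _ _ x.1, w₁ _ _ _ x.2, w₂ _ _ _ x.2, w₃ _ _ _ x.2]
  ring

theorem isPoissonField_field1 : IsPoissonField (field1 (n := n)) dfield1 where
  map_add := field1_add
  map_smul := field1_smul
  differentiable := by
    have h1 := differentiable_grad₁ (n := n)
    have h2 := differentiable_grad₂ (n := n)
    simp only [field1, Ring.lie_def]
    fun_prop
  hasDerivAt x v φ := (hasDerivAt_quadratic (field1 x φ) (dfield1 x v φ) 0).congr_of_eventuallyEq
    (Filter.Eventually.of_forall (field1_line x v φ))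
  skew := field1_skew
  schouten := field1_schouten

/-! ### The moment map and the Poisson field of the second bracket -/

/-- The moment map of the action of quadruples, evaluated on a covector. -/
noncomputable def mom (x : Mat n × Mat n) (φ : Cov n) : Quad n :=
  (x.1 * grad₁ φ, grad₁ φ * x.1, x.2 * grad₂ φ, grad₂ φ * x.2)

/-- The infinitesimal action of quadruples. -/
def act (η : Quad n) (x : Mat n × Mat n) : Mat n × Mat n :=
  (η.1 * x.1 - x.1 * η.2.1, η.2.2.1 * x.2 - x.2 * η.2.2.2)

/-- Cyclicity of the trace. The minus signs in `pair` are those of the right multiplications in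
`act`. -/
theorem cov_act (φ : Cov n) (η : Quad n) (x : Mat n × Mat n) :
    φ (act η x) = pair (mom x φ) η := by
  rw [cov_apply]
  simp only [act, mom, pair, trForm, mul_sub, Matrix.trace_sub]
  rw [← mul_assoc, Matrix.trace_mul_cycle (grad₁ φ), ← mul_assoc (grad₂ φ) η.2.2.1,
    Matrix.trace_mul_cycle (grad₂ φ), mul_assoc (grad₁ φ), mul_assoc (grad₂ φ)]
  ring

/-- Left multiplication and minus right multiplication are commuting representations of the Lie
algebra. -/
theorem act_lie (η ζ : Quad n) (x : Mat n × Mat n) :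
    act ⁅η, ζ⁆ x = act η (act ζ x) - act ζ (act η x) := by
  ext1 <;> simp only [act, Ring.lie_def, Prod.fst_sub, Prod.snd_sub, Prod.fst_mul, Prod.snd_mul] <;>
    noncomm_ring

theorem act_add_left (η ζ : Quad n) (x : Mat n × Mat n) : act (η + ζ) x = act η x + act ζ x := by
  ext1 <;> simp only [act, Prod.fst_add, Prod.snd_add] <;> noncomm_ring

theorem act_smul_left (c : ℂ) (η : Quad n) (x : Mat n × Mat n) : act (c • η) x = c • act η x := by
  ext1 <;> simp [act, smul_sub]

theorem act_add_right (η : Quad n) (x y : Mat n × Mat n) : act η (x + y) = act η x + act η y := by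
  ext1 <;> simp only [act, Prod.fst_add, Prod.snd_add] <;> noncomm_ring

theorem act_smul_right (c : ℂ) (η : Quad n) (x : Mat n × Mat n) : act η (c • x) = c • act η x := by
  ext1 <;> simp [act, smul_sub]

theorem mom_add_left (x y : Mat n × Mat n) (φ : Cov n) : mom (x + y) φ = mom x φ + mom y φ := by
  simp [mom, add_mul, mul_add]

theorem mom_smul_left (c : ℂ) (x : Mat n × Mat n) (φ : Cov n) : mom (c • x) φ = c • mom x φ := by
  simp [mom]

theorem mom_add_right (x : Mat n × Mat n) (φ ψ : Cov n) : mom x (φ + ψ) = mom x φ + mom x ψ := by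
  simp [mom, add_mul, mul_add]

theorem mom_smul_right (c : ℂ) (x : Mat n × Mat n) (φ : Cov n) : mom x (c • φ) = c • mom x φ := by
  simp [mom]

theorem rho_add (ξ η : Quad n) : rho (ξ + η) = rho ξ + rho η := by
  simp only [rho, Prod.fst_add, Prod.snd_add, r_add, r_sub, Prod.mk_add_mk, Prod.mk.injEq]
  refine ⟨?_, ?_, ?_, ?_⟩ <;> module

theorem rho_smul (c : ℂ) (ξ : Quad n) : rho (c • ξ) = c • rho ξ := by
  simp only [rho, Prod.smul_fst, Prod.smul_snd, r_add, r_sub, r_smul, Prod.smul_mk, Prod.mk.injEq]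
  refine ⟨?_, ?_, ?_, ?_⟩ <;> module

/-- The Hamiltonian vector fields of the second bracket. -/
noncomputable def field2 (x : Mat n × Mat n) (φ : Cov n) : Mat n × Mat n := act (rho (mom x φ)) x

/-- The derivative of `field2` along a vector. -/
noncomputable def dfield2 (x v : Mat n × Mat n) (φ : Cov n) : Mat n × Mat n :=
  act (rho (mom v φ)) x + act (rho (mom x φ)) v

theorem field2_add (x : Mat n × Mat n) (φ ψ : Cov n) :
    field2 x (φ + ψ) = field2 x φ + field2 x ψ := by
  rw [field2, mom_add_right, rho_add, act_add_left, field2, field2]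

theorem field2_smul (x : Mat n × Mat n) (c : ℂ) (φ : Cov n) :
    field2 x (c • φ) = c • field2 x φ := by
  rw [field2, mom_smul_right, rho_smul, act_smul_left, field2]

theorem field2_line (x v : Mat n × Mat n) (φ : Cov n) (z : ℂ) :
    field2 (x + z • v) φ = field2 x φ + z • dfield2 x v φ + z ^ 2 • field2 v φ := by
  simp only [field2, dfield2, mom_add_left, mom_smul_left, rho_add, rho_smul, act_add_left,
    act_smul_left, act_add_right, act_smul_right]
  module

theorem field2_skew (x : Mat n × Mat n) (φ ψ : Cov n) : φ (field2 x ψ) = -ψ (field2 x φ) := by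
  rw [field2, field2, cov_act, cov_act, pair_rho]

/-- Skewness of `rho` moves the variation of the moment onto the other covector, so that only
moments at `x` remain. -/
theorem cov_dfield2 (x v : Mat n × Mat n) (φ ψ : Cov n) :
    φ (dfield2 x v ψ) = φ (act (rho (mom x ψ)) v) - ψ (act (rho (mom x φ)) v) := by
  rw [dfield2, map_add, cov_act φ _ x, pair_rho, ← cov_act ψ _ v]
  ring

/-- Moving the leading X cyclically to the end gives the compatibility that `pair_lie_rho` asks of
the left and right components of moments. -/
theorem trForm_mul_lie_mul_comm (A B C X : Mat n) :
    trForm (X * A) ⁅X * B, X * C⁆ = trForm (A * X) ⁅B * X, C * X⁆ := by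
  simp only [trForm, Ring.lie_def, mul_sub, Matrix.trace_sub, mul_assoc]
  rw [Matrix.trace_mul_comm X, Matrix.trace_mul_comm X]
  simp only [mul_assoc]

theorem field2_schouten (x : Mat n × Mat n) (φ ψ χ : Cov n) :
    φ (dfield2 x (field2 x χ) ψ) + ψ (dfield2 x (field2 x φ) χ)
      + χ (dfield2 x (field2 x ψ) φ) = 0 := by
  have key := pair_lie_rho (trForm_mul_lie_mul_comm (grad₁ φ) (grad₁ ψ) (grad₁ χ) x.1)
    (trForm_mul_lie_mul_comm (grad₂ φ) (grad₂ ψ) (grad₂ χ) x.2)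
    (ξ₁ := mom x φ) (ξ₂ := mom x ψ) (ξ₃ := mom x χ) rfl rfl rfl
  -- Each pairing becomes a covector applied to a commutator of two actions on `x`; these six terms
  -- are the ones that `cov_dfield2` produces.
  simp only [← cov_act, act_lie, map_sub] at key
  simp only [cov_dfield2, field2]
  linear_combination key

theorem isPoissonField_field2 : IsPoissonField (field2 (n := n)) dfield2 where
  map_add := field2_add
  map_smul := field2_smul
  differentiable := by
    have h1 := differentiable_grad₁ (n := n)
    have h2 := differentiable_grad₂ (n := n)
    have h3 := differentiable_r (n := n)
    simp only [field2, act, rho, mom]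
    fun_prop
  hasDerivAt x v φ :=
    (hasDerivAt_quadratic (field2 x φ) (dfield2 x v φ) (field2 v φ)).congr_of_eventuallyEq
      (Filter.Eventually.of_forall (field2_line x v φ))
  skew := field2_skew
  schouten := field2_schouten

end Fields

/-! ### The two brackets as Hamiltonian brackets in the chart -/

section Brackets

attribute [local instance] Matrix.linftyOpNormedRing Matrix.linftyOpNormedAlgebra

/-- The open subset of `gl(n, ℂ) × gl(n, ℂ)` identified with `GL(n, ℂ) × gl(n, ℂ)`. -/
def chart (n : ℕ) : Set (Mat n × Mat n) := {p | IsUnit p.1}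

theorem isOpen_chart : IsOpen (chart n) := Units.isOpen.preimage continuous_fst

theorem mem_chart (x : Phase n) : (x.1.val, x.2) ∈ chart n := x.1.isUnit

variable {F H : Phase n → ℂ} {f h : Mat n × Mat n → ℂ}

theorem deriv_comp_curve (hf : DifferentiableOn ℂ f (chart n))
    (hF : ∀ g L, F (g, L) = f (g.val, L)) (x : Phase n) {c : Mat n → ℂ → Phase n}
    {v w : Mat n → Mat n} (hc : ∀ X, c X 0 = x)
    (hv : ∀ X, HasDerivAt (fun z => (c X z).1.val) (v X) 0)
    (hw : ∀ X, HasDerivAt (fun z => (c X z).2) (w X) 0) (X : Mat n) :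
    deriv (fun z => F (c X z)) 0 = fderiv ℂ f (x.1.val, x.2) (v X, w X) := by
  have hd := (hf.differentiableAt (isOpen_chart.mem_nhds (mem_chart x))).hasFDerivAt
  have h2 : HasFDerivAt f (fderiv ℂ f (x.1.val, x.2)) ((c X 0).1.val, (c X 0).2) := by
    rw [hc]; exact hd
  have h3 := h2.comp_hasDerivAt (0 : ℂ) ((hv X).prodMk (hw X))
  exact (congrArg (fun u => deriv u 0) (funext fun z => hF (c X z).1 (c X z).2)).trans h3.deriv

theorem nabla1_eq (hf : DifferentiableOn ℂ f (chart n)) (hF : ∀ g L, F (g, L) = f (g.val, L))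
    (x : Phase n) : nabla1 F x = x.1.val * grad₁ (fderiv ℂ f (x.1.val, x.2)) := by
  ext i j
  rw [← trForm_single (_ * _), trForm, mul_assoc, Matrix.trace_mul_comm, mul_assoc,
    ← trForm, trForm_grad₁]
  exact deriv_comp_curve hf hF x (c := fun X z => (expGL (z • X) * x.1, x.2))
    (v := fun X => X * x.1.val) (w := fun _ => 0)
    (fun X => by simp [expGL_zero]) (fun X => (hasDerivAt_expGL X).mul_const x.1.val)
    (fun X => hasDerivAt_const _ _) (Matrix.single j i 1)

theorem nabla1'_eq (hf : DifferentiableOn ℂ f (chart n)) (hF : ∀ g L, F (g, L) = f (g.val, L))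
    (x : Phase n) : nabla1' F x = grad₁ (fderiv ℂ f (x.1.val, x.2)) * x.1.val := by
  ext i j
  rw [← trForm_single (_ * _), trForm, mul_assoc, ← trForm, trForm_grad₁]
  exact deriv_comp_curve hf hF x (c := fun X z => (x.1 * expGL (z • X), x.2))
    (v := fun X => x.1.val * X) (w := fun _ => 0)
    (fun X => by simp [expGL_zero]) (fun X => (hasDerivAt_expGL X).const_mul x.1.val)
    (fun X => hasDerivAt_const _ _) (Matrix.single j i 1)

theorem d2_eq (hf : DifferentiableOn ℂ f (chart n)) (hF : ∀ g L, F (g, L) = f (g.val, L))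
    (x : Phase n) : d2 F x = grad₂ (fderiv ℂ f (x.1.val, x.2)) := by
  ext i j
  exact deriv_comp_curve hf hF x (c := fun X z => (x.1, x.2 + z • X))
    (v := fun _ => 0) (w := fun X => X) (fun X => by simp)
    (fun X => hasDerivAt_const (0 : ℂ) x.1.val) (fun X => hasDerivAt_line x.2 X)
    (Matrix.single j i 1)

theorem cov_field1 (φ ψ : Cov n) (x : Mat n × Mat n) :
    φ (field1 x ψ) = trForm (x.1 * grad₁ φ) (grad₂ ψ) - trForm (x.1 * grad₁ ψ) (grad₂ φ)
      + trForm x.2 ⁅grad₂ φ, grad₂ ψ⁆ := by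
  rw [cov_apply]
  simp only [field1, Ring.lie_def, trForm, mul_sub, Matrix.trace_sub, mul_assoc]
  have h1 := Matrix.trace_mul_cycle' (grad₁ φ) (grad₂ ψ) x.1
  have h2 := Matrix.trace_mul_cycle' (grad₂ φ) (grad₂ ψ) x.2
  have h3 := (Matrix.trace_mul_cycle' (grad₂ φ) x.2 (grad₂ ψ)).trans
    (Matrix.trace_mul_cycle' _ _ _)
  have h4 := (Matrix.trace_mul_cycle' (grad₂ φ) x.1 (grad₁ ψ)).trans
    (Matrix.trace_mul_cycle' _ _ _)
  linear_combination h1 + h2 - h3 - h4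

theorem bracket1_eq (hf : DifferentiableOn ℂ f (chart n)) (hh : DifferentiableOn ℂ h (chart n))
    (hF : ∀ g L, F (g, L) = f (g.val, L)) (hH : ∀ g L, H (g, L) = h (g.val, L)) (x : Phase n) :
    bracket1 F H x = hamBracket field1 f h (x.1.val, x.2) := by
  rw [bracket1, nabla1_eq hf hF, nabla1_eq hh hH, d2_eq hf hF, d2_eq hh hH]
  exact (cov_field1 _ _ (x.1.val, x.2)).symm

/-- The two sides differ by half of tr(bd) - tr(b'd'), so `h` is needed; on moments, where b =
L·grad and b' = grad·L, it holds by cyclicity. -/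
theorem pair_rho_eq {a a' b b' c c' d d' : Mat n} (h : trForm b d = trForm b' d') :
    pair (a, a', b, b') (rho (c, c', d, d')) =
      trForm (r a) c - trForm (r a') c' + trForm (b - b') (rPlus d' - rMinus d)
        + trForm a (rPlus d' - rMinus d) - trForm c (rPlus b' - rMinus b) := by
  have h1 := trForm_r a c
  have h2 := trForm_r a' c'
  have h3 := trForm_r c (b - b')
  have h4 := trForm_comm (r a) c
  have h5 := trForm_comm (r a') c'
  have h6 := trForm_comm c b
  have h7 := trForm_comm c b'
  simp only [pair, rho, rPlus, rMinus, r_add, r_sub] at *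
  simp only [trForm, mul_add, mul_sub, sub_mul, mul_neg, mul_smul_comm, smul_add,
    smul_sub, Matrix.trace_add, Matrix.trace_sub, Matrix.trace_neg, Matrix.trace_smul, smul_eq_mul] at *
  linear_combination -h1 + h2 - h3 - h4 + h5 + (1 / 2) * (h6 + h7) - (1 / 2) * h

theorem bracket2_eq (hf : DifferentiableOn ℂ f (chart n)) (hh : DifferentiableOn ℂ h (chart n))
    (hF : ∀ g L, F (g, L) = f (g.val, L)) (hH : ∀ g L, H (g, L) = h (g.val, L)) (x : Phase n) :
    bracket2 F H x = hamBracket field2 f h (x.1.val, x.2) := by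
  rw [bracket2, nabla2, nabla2, nabla2', nabla2', nabla1_eq hf hF, nabla1_eq hh hH,
    nabla1'_eq hf hF, nabla1'_eq hh hH, d2_eq hf hF, d2_eq hh hH]
  refine Eq.symm ((cov_act _ _ (x.1.val, x.2)).trans (pair_rho_eq ?_))
  simp only [trForm, mul_assoc]
  rw [Matrix.trace_mul_comm]
  simp only [mul_assoc]

/-- A bracket on functions on `GL(n, ℂ) × gl(n, ℂ)` that is given by a Poisson field defines a
Poisson bracket on the algebra of holomorphic functions. -/
theorem exists_isPoissonBracket {X : Mat n × Mat n → Cov n → Mat n × Mat n}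
    {dX : Mat n × Mat n → Mat n × Mat n → Cov n → Mat n × Mat n} (hX : IsPoissonField X dX)
    {br : (Phase n → ℂ) → (Phase n → ℂ) → Phase n → ℂ}
    (hbr : ∀ (F H : Phase n → ℂ) (f h : Mat n × Mat n → ℂ), DifferentiableOn ℂ f (chart n) →
      DifferentiableOn ℂ h (chart n) → (∀ g L, F (g, L) = f (g.val, L)) →
      (∀ g L, H (g, L) = h (g.val, L)) → ∀ x, br F H x = hamBracket X f h (x.1.val, x.2)) :
    ∃ b : Hol n → Hol n → Hol n,
      (∀ (F H : Hol n) (x : Phase n), (b F H).val x = br F.val H.val x) ∧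
      IsPoissonBracket b := by
  have hol : ∀ F : Hol n, ∃ f : Mat n × Mat n → ℂ, DifferentiableOn ℂ f (chart n) ∧
      ∀ g L, F.val (g, L) = f (g.val, L) := fun F => F.property
  choose e he heF using hol
  have hd : ∀ F H : Hol n, DifferentiableOn ℂ (hamBracket X (e F) (e H)) (chart n) :=
    fun F H => hX.differentiableOn isOpen_chart (he F) (he H)
  have hmem : ∀ F H : Hol n, br F.val H.val ∈ Hol n := fun F H =>
    ⟨hamBracket X (e F) (e H), hd F H, fun g L =>
      hbr _ _ _ _ (he F) (he H) (heF F) (heF H) (g, L)⟩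
  let b : Hol n → Hol n → Hol n := fun F H => ⟨br F.val H.val, hmem F H⟩
  -- Any holomorphic representatives may be used, not only the chosen `e F`. Sums, multiples,
  -- products and brackets can thus be represented by the corresponding expressions in the `e F`,
  -- with no relation needed between `e (F + F')` and `e F`.
  have hb : ∀ F H f h, DifferentiableOn ℂ f (chart n) → DifferentiableOn ℂ h (chart n) →
      (∀ g L, F.val (g, L) = f (g.val, L)) → (∀ g L, H.val (g, L) = h (g.val, L)) →
      ∀ x, (b F H).val x = hamBracket X f h (x.1.val, x.2) := fun F H => hbr F.val H.val
  have hb' : ∀ F H x, (b F H).val x = hamBracket X (e F) (e H) (x.1.val, x.2) := fun F H =>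
    hb F H _ _ (he F) (he H) (heF F) (heF H)
  have hat : ∀ (F : Hol n) (x : Phase n), DifferentiableAt ℂ (e F) (x.1.val, x.2) := fun F x =>
    (he F).differentiableAt (isOpen_chart.mem_nhds (mem_chart x))
  have add_left : ∀ F F' H, b (F + F') H = b F H + b F' H := by
    intro F F' H
    refine Subtype.ext (funext fun x => ?_)
    rw [hb (F + F') H (fun p => e F p + e F' p) (e H) ((he F).add (he F')) (he H)
      (fun g L => congrArg₂ (· + ·) (heF F g L) (heF F' g L)) (heF H)]
    refine Eq.trans ?_ (congrArg₂ (· + ·) (hb' F H x) (hb' F' H x)).symm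
    exact hamBracket_add_left (hat F x) (hat F' x)
  have smul_left : ∀ (c : ℂ) F H, b (c • F) H = c • b F H := by
    intro c F H
    refine Subtype.ext (funext fun x => ?_)
    rw [hb (c • F) H (fun p => c • e F p) (e H) ((he F).const_smul c) (he H)
      (fun g L => congrArg (c • ·) (heF F g L)) (heF H)]
    refine Eq.trans ?_ (congrArg (c • ·) (hb' F H x)).symm
    exact hamBracket_smul_left c (hat F x)
  have leibniz_left : ∀ F F' H, b (F * F') H = F * b F' H + b F H * F' := by
    intro F F' H
    refine Subtype.ext (funext fun x => ?_)
    rw [hb (F * F') H (fun p => e F p * e F' p) (e H) ((he F).mul (he F')) (he H)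
      (fun g L => congrArg₂ (· * ·) (heF F g L) (heF F' g L)) (heF H)]
    refine Eq.trans ?_ (congrArg₂ (· + ·) (congrArg₂ (· * ·) (heF F x.1 x.2) (hb' F' H x))
      (congrArg₂ (· * ·) (hb' F H x) (heF F' x.1 x.2))).symm
    exact hamBracket_mul_left (hat F x) (hat F' x)
  have antisymm : ∀ F H, b F H = -b H F := by
    intro F H
    refine Subtype.ext (funext fun x => ?_)
    exact (hb' F H x).trans ((hX.skew _ _ _).trans (congrArg (- ·) (hb' H F x).symm))
  refine ⟨b, fun _ _ _ => rfl, add_left, smul_left, ?_, ?_, antisymm, leibniz_left, ?_, ?_⟩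
  · intro F H H'
    rw [antisymm, add_left, antisymm F H, antisymm F H', neg_add]
  · intro c F H
    rw [antisymm, smul_left, antisymm F H, smul_neg]
  · intro F H H'
    rw [antisymm, leibniz_left, antisymm F H, antisymm F H']
    ring
  · intro F H K
    refine Subtype.ext (funext fun x => ?_)
    -- The Hamiltonian bracket of representatives is itself a holomorphic representative of `b F H`,
    -- which allows iteration.
    have hbb : ∀ F H K : Hol n, (b (b F H) K).val x =
        hamBracket X (hamBracket X (e F) (e H)) (e K) (x.1.val, x.2) := fun F H K =>
      hb (b F H) K _ _ (hd F H) (he K) (fun g L => hb' F H (g, L)) (heF K) x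
    refine (congrArg₂ (· + ·) (congrArg₂ (· + ·) (hbb F H K) (hbb H K F)) (hbb K F H)).trans ?_
    exact hX.jacobi isOpen_chart (he F) (he H) (he K) (mem_chart x)

end Brackets
end GLPoisson

theorem theorem2p1 (n : ℕ) :
    (∃ b : GLPoisson.Hol n → GLPoisson.Hol n → GLPoisson.Hol n,
      (∀ (F H : GLPoisson.Hol n) (x : GLPoisson.Phase n),
        (b F H).val x = GLPoisson.bracket1 F.val H.val x) ∧
      GLPoisson.IsPoissonBracket b) ∧
    (∃ b : GLPoisson.Hol n → GLPoisson.Hol n → GLPoisson.Hol n,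
      (∀ (F H : GLPoisson.Hol n) (x : GLPoisson.Phase n),
        (b F H).val x = GLPoisson.bracket2 F.val H.val x) ∧
      GLPoisson.IsPoissonBracket b) :=
  ⟨GLPoisson.exists_isPoissonBracket GLPoisson.isPoissonField_field1
      fun _ _ _ _ => GLPoisson.bracket1_eq,
    GLPoisson.exists_isPoissonBracket GLPoisson.isPoissonField_field2
      fun _ _ _ _ => GLPoisson.bracket2_eq⟩
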